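/- Let $\mathcal N=(\mathcal P_v)_{v\in V}$ be a finite abelian network on a directed graph $G=(V,E)$, with total alphabet $A=\bigsqcup_{v\in V}A_v$ and state space $Q=\prod_{v\in V}Q_v$ (with $V$ and all $A_v$, $Q_v$ finite). That is, each $\mathcal P_v$ has commuting transition maps $t_a:Q_v\to Q_v$ ($a\in A_v$), and when it processes the letter $a$ in state $q_v$ it moves to $t_a(q_v)$ and sends a word $o_a^u(q_v)\in A_u^*$ to each out-neighbor $u$ of $v$; if two input words are equal up to permutation, then, from any initial state, so are the resulting output words along each edge. For $\mathbf x\in\mathbb Z^A$ and $\mathbf q\in Q$ let $\mathbf x.\mathbf q$ denote the network with internal states $\mathbf q$ and $\mathbf x_a$ letters $a$ waiting to be processed, for each $a \in A$. Processing a letter $a$ decreases its count by one, changes the state of its processor, and adds the letters sent. A finite sequence of letters is a legal execution if each letter is present (has count at least $1$) when it is processed, and a complete one if no letters remain at the end (all counts are $\le 0$). Assume that $\mathcal N$ halts on all inputs: for all $\mathbf x\in\mathbb N^A$ and $\mathbf q\in Q$ there is a complete legal execution for $\mathbf x.\mathbf q$. Its final state does not depend on the execution and is denoted $\mathbf x\triangleright\!\triangleright\mathbf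 q$. The minimal idempotent of a finite commutative monoid $M$ is the unique idempotent $e\in M$ with $e\in Mm$ for all $m\in M$. Let $e_v$ be the minimal idempotent of the local monoid $M_v=\langle t_a\rangle_{a\in A_v}$ of self-maps of $Q_v$, and let $e$ be that of the global monoid $M$, generated by the maps $\mathbf q\mapsto \mathbf 1_a\triangleright\!\triangleright\mathbf q$ ($a\in A$) of $Q$ to itself. A state $\mathbf q$ is recurrent if $e\mathbf q=\mathbf q$, and locally recurrent if $e_v\mathbf q_v=\mathbf q_v$ for all $v\in V$. Assume that $\mathcal N$ is irreducible: for all $v \in V$ and $q,q'\in Q_v$ there are $m,m'\in M_v$ with $mq=m'q'$. Each $t_a$, $a\in A_v$, permutes $e_vQ_v$, so $\mathbb Z^{A_v}$ acts on $e_vQ_v$; let $K_v$ be the kernel of this action, and let $K=\prod_{v}K_v\subset\mathbb Z^A$ be the total kernel. Let $P:K\to\mathbb Z^A$ be the production map: the group homomorphism such that, for $\mathbf k\in K\cap\mathbb N^A$, $P\mathbf k$ counts the letters sent when $\mathbf k_a$ letters $a$ are processed for each $a\in A$, starting from a locally recurrent state $\mathbf r$ (to which the processors then return). It does not depend on the choice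 of $\mathbf r$. Let $\mathbf k\in K$ be such that $\mathbf k\ge\mathbf 1$ and $P\mathbf k\le\mathbf k$ (coordinatewise). Then $\mathbf q\in Q$ is recurrent if and only if $(I-P)\mathbf k\triangleright\!\triangleright\mathbf q=\mathbf q$. -/

import Mathlib

/-! ### Monoids of self-maps -/

/-- The defining action of a monoid `M` of self-maps of `X` is irreducible: any two points have
a common image. -/
def IsIrreducibleAction {X : Type*} (M : Submonoid (Function.End X)) : Prop :=
  ∀ x x' : X, ∃ m ∈ M, ∃ m' ∈ M, m x = m' x'

/-- `e` is the minimal idempotent of `M`: the idempotent of `M` accessible from all of `M`. It is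
unique if `M` is commutative, and exists if moreover `M` is finite. -/
def IsMinimalIdempotent {X : Type*} (M : Submonoid (Function.End X)) (e : Function.End X) : Prop :=
  e ∈ M ∧ e * e = e ∧ ∀ m ∈ M, ∃ m' ∈ M, e = m' * m

/-- `x` is recurrent for the action of `M`: it is fixed by the minimal idempotent of `M`. -/
def IsRecurrentFor {X : Type*} (M : Submonoid (Function.End X)) (x : X) : Prop :=
  ∃ e, IsMinimalIdempotent M e ∧ e x = x

/-! ### Abelian processors -/

/-- The word sent along one output feed when the input word is processed letter by letter,
from left to right. -/
def outputWord {I Q B : Type*} (t : I → Function.End Q) (o : I → Q → List B) :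
    List I → Q → List B
  | [], _ => []
  | a :: w, q => o a q ++ outputWord t o w (t a q)

/-- An abelian processor with input alphabet `I`, output alphabets `B u` and state space `Q`. -/
structure AbelianProcessor (I : Type*) {U : Type*} (B : U → Type*) (Q : Type*) where
  /-- the state transitions -/
  t : I → Function.End Q
  /-- the message passing functions -/
  o : I → (u : U) → Q → List (B u)
  t_comm : ∀ a b, t a * t b = t b * t a
  o_perm : ∀ w w' : List I, w.Perm w' → ∀ (u : U) (q : Q),
    (outputWord t (fun a => o a u) w q).Perm (outputWord t (fun a => o a u) w' q)

namespace AbelianProcessor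

variable {I U Q : Type*} {B : U → Type*} (p : AbelianProcessor I B Q)

/-- The transition monoid of a processor. -/
def monoid : Submonoid (Function.End Q) := Submonoid.closure (Set.range p.t)

theorem mul_comm_of_mem {m m' : Function.End Q} (hm : m ∈ p.monoid) (hm' : m' ∈ p.monoid) :
    m * m' = m' * m := by
  have := Submonoid.isMulCommutative_closure (Function.End Q) (s := Set.range p.t) (by
    rintro _ ⟨a, rfl⟩ _ ⟨b, rfl⟩
    exact p.t_comm a b)
  exact congrArg Subtype.val (this.is_comm.comm ⟨m, hm⟩ ⟨m', hm'⟩)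

theorem pow_commute (x y : I → ℕ) (a b : I) : Commute (p.t a ^ x a) (p.t b ^ y b) :=
  Commute.pow_pow (p.t_comm a b) _ _

/-- The map `t(x) = ∏ₐ tₐ ^ xₐ`, for `x ∈ ℕ^I`. -/
def trans [Fintype I] (x : I → ℕ) : Function.End Q :=
  Finset.univ.noncommProd (fun a => p.t a ^ x a) fun a _ b _ _ => p.pow_commute x x a b

theorem trans_mem [Fintype I] (x : I → ℕ) : p.trans x ∈ p.monoid :=
  Submonoid.noncommProd_mem _ _ _ _ fun a _ =>
    pow_mem (Submonoid.subset_closure (Set.mem_range_self a)) _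

theorem trans_add [Fintype I] (x y : I → ℕ) : p.trans (x + y) = p.trans x * p.trans y := by
  refine Eq.trans ?_ (Finset.noncommProd_mul_distrib (fun a => p.t a ^ x a)
    (fun a => p.t a ^ y a) _ _ fun a _ b _ _ => p.pow_commute y x a b)
  exact Finset.noncommProd_congr rfl (fun a _ => pow_add (p.t a) (x a) (y a)) _

theorem trans_zero [Fintype I] : p.trans 0 = 1 :=
  (Finset.noncommProd_eq_pow_card _ _ _ 1 fun a _ => pow_zero (p.t a)).trans (one_pow _)

theorem trans_single [Fintype I] [DecidableEq I] (a : I) :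
    p.trans (Pi.single a 1) = p.t a := by
  refine (Finset.mul_noncommProd_erase Finset.univ (Finset.mem_univ a) _ _).symm.trans ?_
  refine (congrArg (p.t a ^ (Pi.single a 1 : I → ℕ) a * ·)
    (Finset.noncommProd_eq_pow_card _ _ _ 1 fun b hb => ?_)).trans ?_
  · simp [Pi.single_eq_of_ne (Finset.ne_of_mem_erase hb)]
  · simp

theorem trans_apply_comm [Fintype I] (x y : I → ℕ) (q : Q) :
    p.trans x (p.trans y q) = p.trans y (p.trans x q) := by
  have h := congrFun ((p.trans_add x y).symm.trans ((congrArg p.trans (add_comm x y)).trans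
    (p.trans_add y x))) q
  exact h

/-- A transition map is injective on recurrent states. -/
theorem trans_injective [Fintype I] (x : I → ℕ) {q q' : Q} (hq : IsRecurrentFor p.monoid q)
    (hq' : IsRecurrentFor p.monoid q') (h : p.trans x q = p.trans x q') : q = q' := by
  obtain ⟨e, ⟨heM, hee, he⟩, heq⟩ := hq
  obtain ⟨f, ⟨hfM, hff, hf⟩, hfq⟩ := hq'
  obtain ⟨m, hm, rfl⟩ := he f hfM
  obtain ⟨m', hm', h2⟩ := hf (m * f) heM
  have hef : m * f = f := by
    calc m * f = (m * f) * f := by rw [mul_assoc, hff]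
      _ = f * (m * f) := p.mul_comm_of_mem heM hfM
      _ = (m' * (m * f)) * (m * f) := by rw [← h2]
      _ = m' * ((m * f) * (m * f)) := mul_assoc _ _ _
      _ = f := by rw [hee, ← h2]
  rw [hef] at heq
  obtain ⟨g, -, hg⟩ := hf _ (p.trans_mem x)
  calc q = g (p.trans x q) := heq.symm.trans (congrFun hg q)
    _ = g (p.trans x q') := by rw [h]
    _ = q' := (congrFun hg q').symm.trans hfq

theorem trans_recurrent [Fintype I] (x : I → ℕ) {q : Q} (hq : IsRecurrentFor p.monoid q) :
    IsRecurrentFor p.monoid (p.trans x q) := by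
  obtain ⟨e, he, heq⟩ := hq
  refine ⟨e, he, ?_⟩
  have h : e * p.trans x = p.trans x * e := p.mul_comm_of_mem he.1 (p.trans_mem x)
  calc e (p.trans x q) = p.trans x (e q) := congrFun h q
    _ = p.trans x q := by rw [heq]

end AbelianProcessor

/-- The positive part of an integer vector. -/
def posVec {ι : Type*} (z : ι → ℤ) : ι → ℕ := fun a => (z a).toNat

theorem posVec_zero {ι : Type*} : posVec (0 : ι → ℤ) = 0 := rfl

theorem posVec_add {ι : Type*} (z w : ι → ℤ) :
    posVec (z + w) + (posVec (-z) + posVec (-w)) =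
      (posVec z + posVec w) + posVec (-(z + w)) := by
  funext a
  simp only [posVec, Pi.add_apply, Pi.neg_apply]
  omega

namespace AbelianProcessor

variable {I U Q : Type*} {B : U → Type*} (p : AbelianProcessor I B Q)

/-- The kernel of the action of `ℤ^I` on the recurrent states of the processor. The vector `z`
acts by `t(z⁺) t(z⁻)⁻¹`, where `z⁺` and `z⁻` are the positive and negative parts of `z`. -/
def kernel [Fintype I] : AddSubgroup (I → ℤ) where
  carrier := {z | ∀ q, IsRecurrentFor p.monoid q →
    p.trans (posVec z) q = p.trans (posVec (-z)) q}
  zero_mem' := by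
    intro q _
    rw [neg_zero]
  neg_mem' := by
    intro z hz q hq
    rw [neg_neg]
    exact (hz q hq).symm
  add_mem' := by
    intro z w hz hw q hq
    have key : ∀ x y : I → ℕ, ∀ s, p.trans (x + y) s = p.trans x (p.trans y s) :=
      fun x y s => congrFun (p.trans_add x y) s
    refine p.trans_injective (posVec (-z) + posVec (-w)) (p.trans_recurrent _ hq)
      (p.trans_recurrent _ hq) ?_
    have h1 : p.trans (posVec z + posVec w) q = p.trans (posVec (-z) + posVec (-w)) q := by
      rw [key, hw q hq, key, hz _ (p.trans_recurrent _ hq)]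
    rw [← key, add_comm, posVec_add, add_comm, key, h1, p.trans_apply_comm]

end AbelianProcessor

/-! ### Abelian networks -/

/-- An abelian network on a directed graph `G` with alphabets `A v` and state spaces `Q v`:
the processor at `v` has one output feed for each out-neighbor of `v`. -/
structure AbelianNetwork {V : Type*} (G : Digraph V) (A Q : V → Type*) where
  proc : ∀ v, AbelianProcessor (A v) (fun u : {u : V // G.Adj v u} => A u.1) (Q v)

/-- The total alphabet, a disjoint union. -/
abbrev Letter {V : Type*} (A : V → Type*) := Σ v, A v

/-- A total state `x.q`: numbers of waiting letters (possibly negative) and internal states. -/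
abbrev TotalState {V : Type*} (A Q : V → Type*) := (Letter A → ℤ) × (∀ v, Q v)

/-- A word with exactly `x a` letters `a`, for each `a`. -/
noncomputable def wordOf {ι : Type*} [Fintype ι] (x : ι → ℕ) : List ι :=
  (∑ a, x a • ({a} : Multiset ι)).toList

theorem wordOf_add {ι : Type*} [Fintype ι] (x y : ι → ℕ) :
    (wordOf (x + y)).Perm (wordOf x ++ wordOf y) := by
  rw [← Multiset.coe_eq_coe, ← Multiset.coe_add]
  simp [wordOf, add_smul, Finset.sum_add_distrib]

theorem wordOf_count {ι : Type*} [Fintype ι] [DecidableEq ι] (x : ι → ℕ) (a : ι) :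
    (wordOf x).count a = x a := by
  rw [← Multiset.coe_count]
  simp [wordOf, Multiset.count_sum', Multiset.count_singleton]

namespace AbelianNetwork

variable {V : Type*} {G : Digraph V} {A Q : V → Type*} (N : AbelianNetwork G A Q)

open Classical in
/-- The number of letters `b` sent when the letter `a` is processed in state `q`. -/
noncomputable def message (a : Letter A) (q : ∀ v, Q v) (b : Letter A) : ℕ :=
  if h : G.Adj a.1 b.1 then ((N.proc a.1).o a.2 ⟨b.1, h⟩ (q a.1)).count b.2 else 0

open Classical in
/-- The new internal states after the letter `a` is processed in state `q`. -/
noncomputable def next (a : Letter A) (q : ∀ v, Q v) : ∀ v, Q v :=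
  Function.update q a.1 ((N.proc a.1).t a.2 (q a.1))

open Classical in
/-- Processing one letter `a`, whether or not such a letter is present. -/
noncomputable def process (a : Letter A) (s : TotalState A Q) : TotalState A Q :=
  (fun b => s.1 b - (if b = a then 1 else 0) + (N.message a s.2 b : ℤ), N.next a s.2)

/-- The result `π_w(x.q)` of executing the word `w`, from left to right. -/
noncomputable def exec (w : List (Letter A)) (s : TotalState A Q) : TotalState A Q :=
  w.foldl (fun s a => N.process a s) s

/-- An execution is legal if each letter is present when it is processed. -/
def IsLegal : List (Letter A) → TotalState A Q → Prop
  | [], _ => True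
  | a :: w, s => 1 ≤ s.1 a ∧ IsLegal w (N.process a s)

/-- An execution is complete if it leaves no letters. -/
def IsComplete (w : List (Letter A)) (s : TotalState A Q) : Prop := (N.exec w s).1 ≤ 0

/-- The network halts on every input `x.q` with `x ∈ ℕ^A`. -/
def HaltsOnAllInputs : Prop :=
  ∀ (x : Letter A → ℕ) (q : ∀ v, Q v), ∃ w,
    N.IsLegal w (fun a => (x a : ℤ), q) ∧ N.IsComplete w (fun a => (x a : ℤ), q)

/-- The global action `x ▷▷ q`: the final state of a complete legal execution for `x.q`. -/
noncomputable def globalAct (h : N.HaltsOnAllInputs) (x : Letter A → ℕ) (q : ∀ v, Q v) :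
    ∀ v, Q v :=
  (N.exec (h x q).choose (fun a => (x a : ℤ), q)).2

open Classical in
/-- The global monoid, generated by the maps `q ↦ 1ₐ ▷▷ q`. -/
noncomputable def globalMonoid (h : N.HaltsOnAllInputs) : Submonoid (Function.End (∀ v, Q v)) :=
  Submonoid.closure (Set.range fun (a : Letter A) (q : ∀ v, Q v) => N.globalAct h (Pi.single a 1) q)

/-- Recurrent states of the network. -/
def IsRecurrent (h : N.HaltsOnAllInputs) (q : ∀ v, Q v) : Prop :=
  IsRecurrentFor (N.globalMonoid h) q

/-- Every processor is irreducible. -/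
def IsIrreducible : Prop := ∀ v, IsIrreducibleAction (N.proc v).monoid

/-- Every processor is in a recurrent state. -/
def IsLocallyRecurrent (q : ∀ v, Q v) : Prop := ∀ v, IsRecurrentFor (N.proc v).monoid (q v)

/-- The total kernel, the product of the kernels of the processors. -/
def totalKernel [∀ v, Fintype (A v)] : AddSubgroup (Letter A → ℤ) where
  carrier := {z | ∀ v, (fun a => z ⟨v, a⟩) ∈ (N.proc v).kernel}
  zero_mem' := fun v => (N.proc v).kernel.zero_mem
  neg_mem' := fun hz v => (N.proc v).kernel.neg_mem (hz v)
  add_mem' := fun hz hw v => (N.proc v).kernel.add_mem (hz v) (hw v)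

/-- The local action `x ▷ s`: add `x` to the waiting letters, then execute `x`. -/
noncomputable def localAct [Fintype V] [∀ v, Fintype (A v)] (x : Letter A → ℕ)
    (s : TotalState A Q) : TotalState A Q :=
  N.exec (wordOf x) (fun a => (x a : ℤ) + s.1 a, s.2)

theorem next_comm (a b : Letter A) (q : ∀ v, Q v) :
    N.next b (N.next a q) = N.next a (N.next b q) := by
  classical
  obtain ⟨v, a⟩ := a
  obtain ⟨u, b⟩ := b
  by_cases h : v = u
  · subst h
    have := congrFun ((N.proc v).t_comm b a) (q v)
    simp only [next, Function.update_self, Function.update_idem]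
    exact congrArg (Function.update q v) this
  · simp only [next, Function.update_of_ne h, Function.update_of_ne (Ne.symm h)]
    exact (Function.update_comm h _ _ _)

theorem message_comm (a b : Letter A) (q : ∀ v, Q v) (c : Letter A) :
    N.message a q c + N.message b (N.next a q) c =
      N.message b q c + N.message a (N.next b q) c := by
  classical
  obtain ⟨v, a⟩ := a
  obtain ⟨u, b⟩ := b
  by_cases h : v = u
  · subst h
    by_cases hc : G.Adj v c.1
    · have := ((N.proc v).o_perm [a, b] [b, a] (List.Perm.swap b a []) ⟨c.1, hc⟩
        (q v)).count_eq c.2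
      simpa [message, next, hc, outputWord] using this
    · simp [message, hc]
  · simp [message, next, Function.update_of_ne h, Function.update_of_ne (Ne.symm h), add_comm]

theorem process_comm (a b : Letter A) (s : TotalState A Q) :
    N.process b (N.process a s) = N.process a (N.process b s) := by
  refine Prod.ext (funext fun c => ?_) (N.next_comm a b s.2)
  have := N.message_comm a b s.2 c
  simp only [process]
  push_cast [← @Nat.cast_inj ℤ] at this
  linarith

theorem exec_perm {w w' : List (Letter A)} (h : w.Perm w') (s : TotalState A Q) :
    N.exec w s = N.exec w' s := by
  have : RightCommutative (fun (s : TotalState A Q) (a : Letter A) => N.process a s) :=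
    ⟨fun s a b => N.process_comm a b s⟩
  exact h.foldl_eq s

theorem exec_shift (w : List (Letter A)) (s : TotalState A Q) (y : Letter A → ℤ) :
    N.exec w (s.1 + y, s.2) = ((N.exec w s).1 + y, (N.exec w s).2) := by
  induction w generalizing s with
  | nil => rfl
  | cons a w ih =>
    have h : N.process a (s.1 + y, s.2) = ((N.process a s).1 + y, (N.process a s).2) := by
      refine Prod.ext (funext fun c => ?_) rfl
      simp only [process, Pi.add_apply]
      ring
    change N.exec w (N.process a (s.1 + y, s.2)) = _
    rw [h, ih]
    rfl

open Classical in
theorem exec_snd [∀ v, Fintype (A v)] (w : List (Letter A)) (s : TotalState A Q) (v : V) :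
    (N.exec w s).2 v = (N.proc v).trans (fun a => w.count ⟨v, a⟩) (s.2 v) := by
  induction w generalizing s with
  | nil =>
    exact (congrFun (N.proc v).trans_zero (s.2 v)).symm
  | cons b w ih =>
    change (N.exec w (N.process b s)).2 v = _
    rw [ih]
    obtain ⟨u, b⟩ := b
    by_cases h : u = v
    · subst h
      have e : (fun a => (((⟨u, b⟩ : Letter A) :: w).count ⟨u, a⟩)) =
          (fun a => w.count (⟨u, a⟩ : Letter A)) + Pi.single b 1 := by
        funext a
        rw [List.count_cons]
        by_cases hab : a = b
        · subst hab; simp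
        · have : b ≠ a := fun h => hab h.symm
          simp [hab, this]
      rw [e, (N.proc u).trans_add, (N.proc u).trans_single]
      simp only [process, next, Function.update_self]
      rfl
    · have e : (fun a => (((⟨u, b⟩ : Letter A) :: w).count ⟨v, a⟩)) =
          (fun a => w.count (⟨v, a⟩ : Letter A)) := by
        funext a
        rw [List.count_cons]
        simp [h]
      rw [e]
      simp only [process, next, Function.update_of_ne (Ne.symm h)]

section Production

variable [Fintype V] [∀ v, Fintype (A v)]

theorem localAct_shift (x : Letter A → ℕ) (s : TotalState A Q) (y : Letter A → ℤ) :
    N.localAct x (s.1 + y, s.2) = ((N.localAct x s).1 + y, (N.localAct x s).2) := by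
  unfold localAct
  rw [← N.exec_shift (wordOf x) (fun a => (x a : ℤ) + s.1 a, s.2) y]
  refine congrArg (N.exec (wordOf x)) (Prod.ext (funext fun c => ?_) rfl)
  simp only [Pi.add_apply]
  ring

theorem localAct_add (x y : Letter A → ℕ) (s : TotalState A Q) :
    N.localAct (x + y) s = N.localAct y (N.localAct x s) := by
  have h : ((fun a => (((x + y) a : ℕ) : ℤ) + s.1 a, s.2) : TotalState A Q) =
      ((fun a => (x a : ℤ) + s.1 a) + (fun a => (y a : ℤ)), s.2) := by
    refine Prod.ext (funext fun c => ?_) rfl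
    simp only [Pi.add_apply, Nat.cast_add]
    ring
  have h2 := N.exec_shift (wordOf x) (fun a => (x a : ℤ) + s.1 a, s.2) (fun a => (y a : ℤ))
  unfold localAct
  rw [N.exec_perm (wordOf_add x y), h]
  unfold exec at h2 ⊢
  rw [List.foldl_append, h2]
  refine congrArg (fun s => List.foldl _ s (wordOf y)) (Prod.ext (funext fun c => ?_) rfl)
  exact add_comm _ _

theorem localAct_snd (x : Letter A → ℕ) (s : TotalState A Q) (v : V) :
    (N.localAct x s).2 v = (N.proc v).trans (fun a => x ⟨v, a⟩) (s.2 v) := by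
  classical
  unfold localAct
  rw [exec_snd]
  simp only [wordOf_count]

/-- The letters sent when `x` is processed in state `q`: the vector `y` with `x ▷ q = y.r`. -/
noncomputable def sent (x : Letter A → ℕ) (q : ∀ v, Q v) : Letter A → ℤ := (N.localAct x (0, q)).1

theorem sent_add (x y : Letter A → ℕ) (q : ∀ v, Q v) :
    N.sent (x + y) q = N.sent x q + N.sent y (N.localAct x (0, q)).2 := by
  have h := N.localAct_shift y (0, (N.localAct x (0, q)).2) (N.localAct x (0, q)).1
  rw [zero_add] at h
  unfold sent
  rw [localAct_add]
  exact (congrArg Prod.fst h).trans (add_comm _ _)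

theorem sent_diff_add {x y x' y' : Letter A → ℕ} {q : ∀ v, Q v}
    (h : (N.localAct x (0, q)).2 = (N.localAct y (0, q)).2)
    (h' : (N.localAct x' (0, q)).2 = (N.localAct y' (0, q)).2) :
    N.sent (x + x') q - N.sent (y + y') q =
      (N.sent x q - N.sent y q) + (N.sent x' q - N.sent y' q) := by
  have h1 := N.sent_add x x' q
  have h2 := N.sent_add x' x q
  have h3 := N.sent_add x y' q
  have h4 := N.sent_add y' x q
  have h5 := N.sent_add y y' q
  rw [add_comm x' x, h'] at h2
  rw [add_comm y' x] at h4
  rw [← h] at h5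
  rw [h5, h2, eq_sub_of_add_eq' (h3.symm.trans h4)]
  abel

theorem localAct_posVec_of_mem {z : Letter A → ℤ} (hz : z ∈ N.totalKernel) {r : ∀ v, Q v}
    (hr : N.IsLocallyRecurrent r) :
    (N.localAct (posVec z) (0, r)).2 = (N.localAct (posVec (-z)) (0, r)).2 := by
  funext v
  rw [localAct_snd, localAct_snd]
  exact hz v (r v) (hr v)

/-- The production map `P_r : K → ℤ^A` at a locally recurrent state `r`: the homomorphism with
`k ▷ r = P_r(k).r` for all nonnegative `k ∈ K` (`localAct_eq_production`). For `k ∈ K` of mixed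
sign the vectors `k⁺` and `k⁻` lead from `r` to the same state, and `P_r(k)` is the difference
of the letters sent. -/
noncomputable def production (r : ∀ v, Q v) (hr : N.IsLocallyRecurrent r) :
    N.totalKernel →+ (Letter A → ℤ) where
  toFun k := N.sent (posVec k.1) r - N.sent (posVec (-k.1)) r
  map_zero' := by simp
  map_add' := by
    intro z w
    have hz := N.localAct_posVec_of_mem z.2 hr
    have hw := N.localAct_posVec_of_mem w.2 hr
    have hs := N.localAct_posVec_of_mem (z + w).2 hr
    have hzw : (N.localAct (posVec z.1 + posVec w.1) (0, r)).2 =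
        (N.localAct (posVec (-z.1) + posVec (-w.1)) (0, r)).2 := by
      have key : ∀ x y : Letter A → ℕ, (N.localAct (x + y) (0, r)).2 =
          (N.localAct y (0, (N.localAct x (0, r)).2)).2 := by
        intro x y
        funext v
        rw [localAct_add, localAct_snd, localAct_snd, localAct_snd, localAct_snd]
      rw [key, hz, ← key, add_comm, key, hw, ← key, add_comm]
    have h1 := N.sent_diff_add hs
      (rfl : (N.localAct (posVec (-z.1) + posVec (-w.1)) (0, r)).2 = _)
    have h2 := N.sent_diff_add hzw
      (rfl : (N.localAct (posVec (-(z.1 + w.1))) (0, r)).2 = _)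
    rw [AddSubgroup.coe_add, posVec_add] at h1
    rw [sub_self, add_zero] at h1 h2
    rw [AddSubgroup.coe_add, ← N.sent_diff_add hz hw, ← h2, ← h1, add_comm (posVec (-z.1) + _)]

theorem localAct_eq_production (r : ∀ v, Q v) (hr : N.IsLocallyRecurrent r) (k : N.totalKernel)
    (hk : 0 ≤ k.1) : N.localAct (posVec k.1) (0, r) = (N.production r hr k, r) := by
  have h0 : posVec (-k.1) = 0 := by
    funext a
    have := hk a
    simp only [posVec, Pi.neg_apply, Pi.zero_apply] at this ⊢
    omega
  have h1 : N.localAct 0 (0, r) = (0, r) := by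
    simp only [localAct, wordOf, Pi.zero_apply, zero_smul, Finset.sum_const_zero,
      Multiset.toList_zero]
    exact Prod.ext (funext fun c => by simp [exec]) rfl
  refine Prod.ext ?_ ?_
  · change _ = N.sent (posVec k.1) r - N.sent (posVec (-k.1)) r
    rw [h0]
    unfold sent
    rw [h1, sub_zero]
  · rw [N.localAct_posVec_of_mem k.2 hr, h0, h1]

end Production

end AbelianNetwork

/-! ### Transition monoids and idempotent powers. -/

namespace AbelianProcessor

variable {I U Q : Type*} {B : U → Type*} (p : AbelianProcessor I B Q)

/-! Put x = (I - P)k. If q is recurrent, it is locally recurrent (`IsRecurrent.isLocallyRecurrent`),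
so processing k returns q to itself and sends Pk. Recurrence also gives some y = k + d with y ▷▷ q =
q. Since (k + d).q leads legally to (Pk + d).q, also (Pk + d) ▷▷ q = q. Adding x turns Pk + d back
into k + d, whence x ▷▷ q = q.

Conversely, x ▷▷ q = q gives nx ▷▷ q = q for all n. If some nx.q leads legally to y.p with y above a
vector z whose action is the minimal idempotent, then q = y ▷▷ p is recurrent. So it suffices that
copies of x can create every letter in abundance (`IsIrreducible.abundant_univ`).

Let R be a maximal abundant set containing the support of x. For a letter a outside R there is a
state from which letters of R never produce a; otherwise a could be added to R (`Abundant.insert`).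
By irreducibility, letters of R then send only boundedly many a from any state. But nk sends nk -
nx, which is nk outside R, so the part c of k outside R reproduces itself up to a bounded error.
Over a period of the state this error must vanish, and halting forces c = 0
(`eq_zero_of_bounded_defect`). As k ≥ 1, R contains every letter. -/

theorem exists_trans_eq_of_mem_monoid [Fintype I] {m : Function.End Q} (hm : m ∈ p.monoid) :
    ∃ x, p.trans x = m := by
  classical
  induction hm using Submonoid.closure_induction with
  | mem m hm =>
    obtain ⟨a, rfl⟩ := hm
    exact ⟨_, p.trans_single a⟩
  | one => exact ⟨0, p.trans_zero⟩
  | mul m m' _ _ h h' =>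
    obtain ⟨x, rfl⟩ := h
    obtain ⟨y, rfl⟩ := h'
    exact ⟨x + y, p.trans_add x y⟩

end AbelianProcessor

/-- Some positive power of any element of a finite monoid is idempotent. -/
theorem exists_idempotent_pow {M : Type*} [Monoid M] [Finite M] (m : M) :
    ∃ n, 0 < n ∧ m ^ n * m ^ n = m ^ n := by
  obtain ⟨i, j, hij, h⟩ := Finite.exists_ne_map_eq_of_infinite (fun n : ℕ => m ^ n)
  wlog hlt : i < j generalizing i j
  · exact this j i hij.symm h.symm (by omega)
  obtain ⟨d, rfl⟩ := Nat.exists_eq_add_of_lt hlt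
  -- From exponent i on, the powers of m have period d + 1.
  have step : ∀ n, i ≤ n → m ^ (n + (d + 1)) = m ^ n := by
    intro n hn
    obtain ⟨c, rfl⟩ := Nat.exists_eq_add_of_le hn
    have h' : m ^ i = m ^ (i + d + 1) := h
    rw [show i + c + (d + 1) = (i + d + 1) + c by ring, pow_add, ← h', ← pow_add]
  have steps : ∀ t n, i ≤ n → m ^ (n + t * (d + 1)) = m ^ n := by
    intro t
    induction t with
    | zero => simp
    | succ t ih =>
      intro n hn
      rw [add_mul, one_mul, ← add_assoc, step _ (by omega), ih n hn]
  -- A positive multiple of the period that is at least i, so doubling it does not change the power.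
  refine ⟨(i + 1) * (d + 1), by positivity, ?_⟩
  rw [← pow_add]
  exact steps _ _ (by nlinarith)

namespace AbelianNetwork

variable {V : Type*} {G : Digraph V} {A Q : V → Type*} (N : AbelianNetwork G A Q)

/-! ### Legal executions and the least action principle -/

theorem exec_append (w w' : List (Letter A)) (s : TotalState A Q) :
    N.exec (w ++ w') s = N.exec w' (N.exec w s) :=
  List.foldl_append

-- Messages only add letters, so the count of a drops by at most one for each a processed.
open Classical in
theorem sub_count_le_exec (w : List (Letter A)) (s : TotalState A Q) (a : Letter A) :
    s.1 a - w.count a ≤ (N.exec w s).1 a := by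
  induction w generalizing s with
  | nil => simp [exec]
  | cons b w ih =>
    refine le_trans ?_ (ih (N.process b s))
    simp only [process, List.count_cons, beq_iff_eq, eq_comm (a := b)]
    split_ifs <;> push_cast <;> linarith [(N.message b s.2 a).cast_nonneg (α := ℤ)]

theorem isLegal_append {w w' : List (Letter A)} {s : TotalState A Q} (h : N.IsLegal w s)
    (h' : N.IsLegal w' (N.exec w s)) : N.IsLegal (w ++ w') s := by
  induction w generalizing s with
  | nil => exact h'
  | cons a w ih => exact ⟨h.1, ih h.2 h'⟩

theorem isLegal_mono {w : List (Letter A)} {x y : Letter A → ℤ} {q : ∀ v, Q v} (hxy : x ≤ y)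
    (h : N.IsLegal w (x, q)) : N.IsLegal w (y, q) := by
  induction w generalizing x y q with
  | nil => trivial
  | cons a w ih =>
    refine ⟨h.1.trans (hxy a), ih ?_ h.2⟩
    intro b
    have := hxy b
    change x b - _ + _ ≤ y b - _ + _
    linarith

theorem exec_nonneg {w : List (Letter A)} {s : TotalState A Q} (h : N.IsLegal w s)
    (hs : 0 ≤ s.1) : 0 ≤ (N.exec w s).1 := by
  classical
  induction w generalizing s with
  | nil => exact hs
  | cons a w ih =>
    refine ih h.2 fun b => ?_
    have h1 := h.1
    have h2 := hs b
    simp only [process, Pi.zero_apply] at h2 ⊢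
    split_ifs with hb
    · subst hb; linarith [(N.message b s.2 b).cast_nonneg (α := ℤ)]
    · linarith [(N.message a s.2 b).cast_nonneg (α := ℤ)]

-- All letters of w are present at the start, so legality does not depend on the messages sent on
-- the way.
open Classical in
theorem isLegal_of_count_le {w : List (Letter A)} {s : TotalState A Q}
    (h : ∀ a, (w.count a : ℤ) ≤ s.1 a) : N.IsLegal w s := by
  induction w generalizing s with
  | nil => trivial
  | cons a w ih =>
    refine ⟨?_, ih fun b => ?_⟩
    · have := h a
      rw [List.count_cons_self] at this
      push_cast at this
      linarith [(w.count a).cast_nonneg (α := ℤ)]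
    · have h1 := h b
      have h2 := N.sub_count_le_exec [a] s b
      simp only [List.count_cons, List.count_nil, exec, List.foldl] at h1 h2
      push_cast at h1 h2
      linarith

/-- The least action principle: a legal execution is contained in any complete execution. -/
theorem subperm_of_isLegal_of_isComplete {w w' : List (Letter A)} {s : TotalState A Q}
    (hw : N.IsLegal w s) (hw' : N.IsComplete w' s) : w.Subperm w' := by
  classical
  induction w generalizing w' s with
  | nil => exact List.nil_subperm
  | cons a w ih =>
    have ha : a ∈ w' := by
      by_contra hmem
      have h1 := N.sub_count_le_exec w' s a
      have h2 := hw' a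
      rw [List.count_eq_zero_of_not_mem hmem] at h1
      have h3 := hw.1
      simp only [Pi.zero_apply, Nat.cast_zero] at h1 h2
      linarith
    have hp := List.perm_cons_erase ha
    -- By commutativity the a in w' may be processed first; the rest of w' is then complete for the
    -- state after a.
    refine List.Subperm.trans ((List.subperm_cons a).2 (ih hw.2 ?_)) hp.symm.subperm
    have := N.exec_perm hp s
    unfold IsComplete at hw' ⊢
    rw [this] at hw'
    exact hw'

theorem perm_of_isLegal_of_isComplete {w w' : List (Letter A)} {s : TotalState A Q}
    (hw : N.IsLegal w s) (hc : N.IsComplete w s) (hw' : N.IsLegal w' s)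
    (hc' : N.IsComplete w' s) : w.Perm w' :=
  (N.subperm_of_isLegal_of_isComplete hw hc').antisymm (N.subperm_of_isLegal_of_isComplete hw' hc)

/-- Some legal execution leads from `x.q` to `y.p`. -/
def Leads (x : Letter A → ℕ) (q : ∀ v, Q v) (y : Letter A → ℕ) (p : ∀ v, Q v) : Prop :=
  ∃ w, N.IsLegal w (fun a => (x a : ℤ), q) ∧
    N.exec w (fun a => (x a : ℤ), q) = (fun a => (y a : ℤ), p)

variable {N} in
theorem Leads.trans {x y z : Letter A → ℕ} {q p s : ∀ v, Q v} (h : N.Leads x q y p)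
    (h' : N.Leads y p z s) : N.Leads x q z s := by
  obtain ⟨w, hw, he⟩ := h
  obtain ⟨w', hw', he'⟩ := h'
  exact ⟨w ++ w', N.isLegal_append hw (he ▸ hw'), by rw [exec_append, he, he']⟩

variable {N} in
theorem Leads.add_right {x y : Letter A → ℕ} {q p : ∀ v, Q v} (h : N.Leads x q y p)
    (z : Letter A → ℕ) : N.Leads (x + z) q (y + z) p := by
  obtain ⟨w, hw, he⟩ := h
  have hx : ∀ u : Letter A → ℕ, (fun a => ((u + z) a : ℤ)) =
      (fun a => (u a : ℤ)) + fun a => (z a : ℤ) := by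
    intro u; funext a; simp
  refine ⟨w, N.isLegal_mono (fun a => ?_) hw, ?_⟩
  · simp
  · rw [hx x, N.exec_shift w (fun a => (x a : ℤ), q), he, hx y]

/-- Legal executions keep counts nonnegative, so `posVec` truncates nothing here. -/
theorem exists_leads {w : List (Letter A)} {x : Letter A → ℕ} {q : ∀ v, Q v}
    (hw : N.IsLegal w (fun a => (x a : ℤ), q)) :
    N.Leads x q (posVec (N.exec w (fun a => (x a : ℤ), q)).1)
      (N.exec w (fun a => (x a : ℤ), q)).2 := by
  refine ⟨w, hw, Prod.ext (funext fun a => ?_) rfl⟩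
  have := N.exec_nonneg hw (fun a => Int.natCast_nonneg _) a
  exact (Int.toNat_of_nonneg this).symm

/-! ### The global action -/

section Global

variable (h : N.HaltsOnAllInputs)

theorem leads_globalAct (x : Letter A → ℕ) (q : ∀ v, Q v) :
    N.Leads x q 0 (N.globalAct h x q) := by
  have hc := (h x q).choose_spec
  refine ⟨_, hc.1, Prod.ext (funext fun a => le_antisymm (hc.2 a) ?_) rfl⟩
  exact N.exec_nonneg hc.1 (fun a => Int.natCast_nonneg _) a

-- Makes the global action independent of the execution chosen in `globalAct`.
variable {N} in
theorem Leads.globalAct_eq_of_zero {x : Letter A → ℕ} {q p : ∀ v, Q v} (hl : N.Leads x q 0 p) :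
    N.globalAct h x q = p := by
  obtain ⟨w, hw, he⟩ := hl
  obtain ⟨w', hw', he'⟩ := N.leads_globalAct h x q
  have hp := N.perm_of_isLegal_of_isComplete hw (le_of_eq (by rw [he]; rfl)) hw'
    (le_of_eq (by rw [he']; rfl))
  rw [N.exec_perm hp, he'] at he
  exact congrArg Prod.snd he

variable {N} in
theorem Leads.globalAct_eq {x y : Letter A → ℕ} {q p : ∀ v, Q v} (hl : N.Leads x q y p) :
    N.globalAct h x q = N.globalAct h y p :=
  Leads.globalAct_eq_of_zero h (hl.trans (N.leads_globalAct h y p))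

theorem globalAct_zero (q : ∀ v, Q v) : N.globalAct h 0 q = q :=
  Leads.globalAct_eq_of_zero h ⟨[], trivial, rfl⟩

theorem globalAct_add (x y : Letter A → ℕ) (q : ∀ v, Q v) :
    N.globalAct h (x + y) q = N.globalAct h x (N.globalAct h y q) := by
  have := ((N.leads_globalAct h y q).add_right x).globalAct_eq h
  rwa [zero_add, add_comm] at this

/-- If `c.s` leads to `(c + d).s`, then nothing has been processed. -/
theorem eq_nil_of_exec_ge (h : N.HaltsOnAllInputs) {c d : Letter A → ℕ} {s : ∀ v, Q v}
    {w : List (Letter A)} (hw : N.IsLegal w (fun a => (c a : ℤ), s))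
    (he : N.exec w (fun a => (c a : ℤ), s) = (fun a => ((c + d) a : ℤ), s)) : w = [] := by
  -- Least action gives |w| + |w₂| ≤ |w₁| ≤ |w₂|, where w₁ and w₂ finish off c.s and (c + d).s.
  obtain ⟨w₁, hw₁, hc₁⟩ := h c s
  obtain ⟨w₂, hw₂, hc₂⟩ := h (c + d) s
  have h1 : (w ++ w₂).Subperm w₁ :=
    N.subperm_of_isLegal_of_isComplete (N.isLegal_append hw (he ▸ hw₂)) hc₁
  have h2 : w₁.Subperm w₂ :=
    N.subperm_of_isLegal_of_isComplete (N.isLegal_mono (fun a => by simp) hw₁) hc₂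
  have h3 := h1.length_le
  have h4 := h2.length_le
  rw [List.length_append] at h3
  exact List.eq_nil_of_length_eq_zero (by omega)

/-- The map `q ↦ x ▷▷ q`, as an element of the monoid of self-maps. -/
noncomputable def globalMap (x : Letter A → ℕ) : Function.End (∀ v, Q v) := N.globalAct h x

theorem globalMap_zero : N.globalMap h 0 = 1 := funext fun q => N.globalAct_zero h q

theorem globalMap_add (x y : Letter A → ℕ) :
    N.globalMap h (x + y) = N.globalMap h x * N.globalMap h y :=
  funext fun q => N.globalAct_add h x y q

theorem globalMap_nsmul (n : ℕ) (x : Letter A → ℕ) :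
    N.globalMap h (n • x) = N.globalMap h x ^ n := by
  induction n with
  | zero => rw [zero_smul, pow_zero, globalMap_zero]
  | succ n ih => rw [succ_nsmul, pow_succ, ← ih, globalMap_add]

theorem mem_globalMonoid_iff [Fintype V] [∀ v, Fintype (A v)] {m : Function.End (∀ v, Q v)} :
    m ∈ N.globalMonoid h ↔ ∃ x, m = N.globalMap h x := by
  classical
  constructor
  · intro hm
    induction hm using Submonoid.closure_induction with
    | mem m hm =>
      obtain ⟨a, rfl⟩ := hm
      refine ⟨Pi.single a 1, funext fun q => ?_⟩
      unfold globalMap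
      congr!
    | one => exact ⟨0, (N.globalMap_zero h).symm⟩
    | mul m m' _ _ h₁ h₂ =>
      obtain ⟨x, rfl⟩ := h₁
      obtain ⟨y, rfl⟩ := h₂
      exact ⟨x + y, (N.globalMap_add h x y).symm⟩
  · rintro ⟨x, rfl⟩
    rw [← Finset.univ_sum_single x]
    refine Finset.sum_induction _ (fun y => N.globalMap h y ∈ N.globalMonoid h) ?_ ?_ ?_
    · intro x y hx hy
      rw [globalMap_add]
      exact mul_mem hx hy
    · rw [globalMap_zero]
      exact one_mem _
    · intro a _
      have : Pi.single a (x a) = x a • (Pi.single a 1 : Letter A → ℕ) := by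
        rw [← Pi.single_smul, smul_eq_mul, mul_one]
      rw [this, globalMap_nsmul]
      refine pow_mem ?_ _
      refine Submonoid.subset_closure (Set.mem_range.2 ⟨a, ?_⟩)
      unfold globalMap
      congr!

-- Minimality factors e through the action of z, so q is fixed by a vector that contains z.
variable {N} in
theorem IsRecurrent.exists_le_globalAct_eq [Fintype V] [∀ v, Fintype (A v)] {q : ∀ v, Q v}
    (hq : N.IsRecurrent h q) (z : Letter A → ℕ) : ∃ y, z ≤ y ∧ N.globalAct h y q = q := by
  obtain ⟨e, ⟨-, -, he⟩, heq⟩ := hq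
  obtain ⟨m, hm, hem⟩ := he _ ((N.mem_globalMonoid_iff h).2 ⟨z, rfl⟩)
  obtain ⟨y, rfl⟩ := (N.mem_globalMonoid_iff h).1 hm
  refine ⟨y + z, le_add_self, ?_⟩
  rw [globalAct_add]
  exact (congrFun hem q).symm.trans heq

theorem exists_isMinimalIdempotent [Fintype V] [∀ v, Fintype (A v)] [∀ v, Finite (Q v)] :
    ∃ z, IsMinimalIdempotent (N.globalMonoid h) (N.globalMap h z) := by
  classical
  have : Finite (Function.End (∀ v, Q v)) := inferInstanceAs (Finite ((∀ v, Q v) → (∀ v, Q v)))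
  have := Fintype.ofFinite (N.globalMonoid h)
  choose f hf using fun m : N.globalMonoid h => (N.mem_globalMonoid_iff h).1 m.2
  -- The sum of representatives of all elements acts as a multiple of each of them; an idempotent
  -- power of it keeps this property.
  obtain ⟨n, hn, hid⟩ := exists_idempotent_pow (N.globalMap h (∑ m, f m))
  rw [← globalMap_nsmul] at hid
  refine ⟨n • ∑ m, f m, (N.mem_globalMonoid_iff h).2 ⟨_, rfl⟩, hid, fun m hm => ?_⟩
  have hle : f ⟨m, hm⟩ ≤ n • ∑ m, f m :=
    (Finset.single_le_sum (f := f) (fun _ _ => zero_le) (Finset.mem_univ _)).trans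
      (le_self_nsmul zero_le hn.ne')
  obtain ⟨y, hy⟩ := exists_add_of_le hle
  refine ⟨N.globalMap h y, (N.mem_globalMonoid_iff h).2 ⟨_, rfl⟩, ?_⟩
  rw [hy, add_comm, globalMap_add, ← hf ⟨m, hm⟩]

-- The action of y factors through the idempotent of z, which fixes its image.
variable {N} in
theorem isRecurrent_globalAct {z y : Letter A → ℕ}
    (hz : IsMinimalIdempotent (N.globalMonoid h) (N.globalMap h z)) (hzy : z ≤ y) (p : ∀ v, Q v) :
    N.IsRecurrent h (N.globalAct h y p) := by
  refine ⟨_, hz, ?_⟩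
  obtain ⟨d, rfl⟩ := exists_add_of_le hzy
  rw [globalAct_add]
  exact congrFun hz.2.1 _

end Global

/-! ### The local action -/

section Local

variable [Fintype V] [∀ v, Fintype (A v)]

/-- The state reached when `x` is processed in state `q`. -/
noncomputable def localState (x : Letter A → ℕ) (q : ∀ v, Q v) : ∀ v, Q v :=
  (N.localAct x (0, q)).2

theorem localState_apply (x : Letter A → ℕ) (q : ∀ v, Q v) (v : V) :
    N.localState x q v = (N.proc v).trans (fun a => x ⟨v, a⟩) (q v) :=
  N.localAct_snd x (0, q) v

theorem localState_add (x y : Letter A → ℕ) (q : ∀ v, Q v) :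
    N.localState (x + y) q = N.localState y (N.localState x q) := by
  funext v
  simp only [localState, localAct_add, localAct_snd]

theorem sent_add_localState (x y : Letter A → ℕ) (q : ∀ v, Q v) :
    N.sent (x + y) q = N.sent x q + N.sent y (N.localState x q) :=
  N.sent_add x y q

theorem exec_wordOf (u : Letter A → ℕ) (q : ∀ v, Q v) :
    N.exec (wordOf u) (fun a => (u a : ℤ), q) = (N.sent u q, N.localState u q) := by
  have : ((fun a => (u a : ℤ), q) : TotalState A Q) =
      (fun a => (u a : ℤ) + (0 : Letter A → ℤ) a, q) := by simp
  rw [this]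
  rfl

theorem isLegal_wordOf (u : Letter A → ℕ) (q : ∀ v, Q v) :
    N.IsLegal (wordOf u) (fun a => (u a : ℤ), q) := by
  classical
  exact N.isLegal_of_count_le fun a => by rw [wordOf_count]

theorem sent_nonneg (u : Letter A → ℕ) (q : ∀ v, Q v) : 0 ≤ N.sent u q := by
  have := N.exec_nonneg (N.isLegal_wordOf u q) fun a => Int.natCast_nonneg _
  rwa [exec_wordOf] at this

theorem leads_localState (u : Letter A → ℕ) (q : ∀ v, Q v) :
    N.Leads u q (posVec (N.sent u q)) (N.localState u q) := by
  have := N.exists_leads (N.isLegal_wordOf u q)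
  rwa [exec_wordOf] at this

theorem localState_zero (s : ∀ v, Q v) : N.localState 0 s = s := by
  funext v
  rw [localState_apply]
  exact congrFun (N.proc v).trans_zero _

theorem sent_zero (s : ∀ v, Q v) : N.sent 0 s = 0 := by
  have h := N.sent_add_localState 0 0 s
  rw [add_zero, localState_zero] at h
  exact left_eq_add.1 h

theorem localState_nsmul {c : Letter A → ℕ} {s : ∀ v, Q v} (hs : N.localState c s = s) (n : ℕ) :
    N.localState (n • c) s = s := by
  induction n with
  | zero => rw [zero_smul, localState_zero]
  | succ n ih => rw [succ_nsmul, localState_add, ih, hs]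

theorem sent_nsmul {c : Letter A → ℕ} {s : ∀ v, Q v} (hs : N.localState c s = s) (n : ℕ)
    (a : Letter A) : N.sent (n • c) s a = n * N.sent c s a := by
  induction n with
  | zero => simp [sent_zero]
  | succ n ih =>
    rw [succ_nsmul, sent_add_localState, N.localState_nsmul hs, Pi.add_apply, ih]
    push_cast
    ring

/-- Process c and x in either order: the totals agree, and x sends the same in both because c
returns to s. -/
theorem sent_localState {c : Letter A → ℕ} {s : ∀ v, Q v} (hs : N.localState c s = s)
    (x : Letter A → ℕ) : N.sent c (N.localState x s) = N.sent c s := by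
  have h1 := N.sent_add_localState c x s
  rw [add_comm, sent_add_localState, hs, add_comm] at h1
  exact add_right_cancel h1

variable {N} in
theorem IsIrreducible.exists_localState_eq (hirr : N.IsIrreducible) (p q : ∀ v, Q v) :
    ∃ x y, N.localState x p = N.localState y q := by
  choose m hm m' hm' h using fun v => hirr v (p v) (q v)
  choose f hf using fun v => (N.proc v).exists_trans_eq_of_mem_monoid (hm v)
  choose g hg using fun v => (N.proc v).exists_trans_eq_of_mem_monoid (hm' v)
  refine ⟨fun a => f a.1 a.2, fun a => g a.1 a.2, funext fun v => ?_⟩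
  rw [localState_apply, localState_apply, hf, hg, h]

-- This is why P does not depend on the base state: both sides equal the output of c at a common
-- descendant of p and q.
variable {N} in
theorem IsIrreducible.sent_eq (hirr : N.IsIrreducible) {c : Letter A → ℕ} {p q : ∀ v, Q v}
    (hp : N.localState c p = p) (hq : N.localState c q = q) : N.sent c p = N.sent c q := by
  obtain ⟨x, y, h⟩ := hirr.exists_localState_eq p q
  rw [← N.sent_localState hp x, h, N.sent_localState hq]

/-- A nonzero vector that reproduces itself prevents halting. -/
theorem eq_zero_of_le_sent (h : N.HaltsOnAllInputs) {c : Letter A → ℕ} {s : ∀ v, Q v}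
    (hs : N.localState c s = s) (hc : ∀ a, (c a : ℤ) ≤ N.sent c s a) : c = 0 := by
  classical
  -- Here d is the surplus of the letters sent over c.
  have := N.eq_nil_of_exec_ge h (d := posVec (N.sent c s - fun a => (c a : ℤ)))
    (N.isLegal_wordOf c s) (by
      rw [exec_wordOf, hs]
      refine Prod.ext (funext fun a => ?_) rfl
      have := hc a
      simp only [Pi.add_apply, posVec, Pi.sub_apply]
      omega)
  funext a
  rw [← wordOf_count c a, this]
  rfl

end Local

end AbelianNetwork

namespace AbelianNetwork

variable {V : Type*} {G : Digraph V} {A Q : V → Type*} {N : AbelianNetwork G A Q}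

/-! ### Letters available in abundance -/

/-- From any state, sufficiently many copies of `x` lead legally to a configuration with many
letters waiting of each kind in `R`. -/
def Abundant (N : AbelianNetwork G A Q) (x : Letter A → ℕ) (R : Set (Letter A)) : Prop :=
  ∀ (C : ℕ) (p : ∀ v, Q v), ∃ (n : ℕ) (y : Letter A → ℕ) (p' : ∀ v, Q v),
    N.Leads (n • x) p y p' ∧ ∀ a ∈ R, C ≤ y a

theorem Leads.add_nsmul {x y z : Letter A → ℕ} {m n : ℕ} {q p s : ∀ v, Q v}
    (h : N.Leads (m • x) q y p) (h' : N.Leads (n • x) p z s) :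
    N.Leads ((m + n) • x) q (y + z) s := by
  have h1 := h.add_right (n • x)
  have h2 := h'.add_right y
  rw [add_smul, add_comm y z]
  rw [add_comm] at h2
  exact h1.trans h2

theorem abundant_support (x : Letter A → ℕ) : N.Abundant x {a | x a ≠ 0} := by
  intro C p
  refine ⟨C, C • x, p, ⟨[], trivial, rfl⟩, fun a ha => ?_⟩
  exact Nat.le_mul_of_pos_right _ (Nat.pos_of_ne_zero ha)

variable [Fintype V] [∀ v, Fintype (A v)]

/-! ### Recurrent states are locally recurrent -/

/-- A loop at q can be made to process enough letters at each v for its local transition to factor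
through the minimal idempotent. The state r only supplies these idempotents. -/
theorem IsRecurrent.isLocallyRecurrent {h : N.HaltsOnAllInputs} {q : ∀ v, Q v}
    (hq : N.IsRecurrent h q) {r : ∀ v, Q v} (hr : N.IsLocallyRecurrent r) :
    N.IsLocallyRecurrent q := by
  classical
  choose e he _ using hr
  choose f hf using fun v => (N.proc v).exists_trans_eq_of_mem_monoid (he v).1
  obtain ⟨y, hzy, hyq⟩ := hq.exists_le_globalAct_eq h fun a => f a.1 a.2
  obtain ⟨w, -, hw⟩ := N.leads_globalAct h y q
  intro v
  refine ⟨e v, he v, ?_⟩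
  have hle : f v ≤ fun a => w.count ⟨v, a⟩ := by
    intro a
    have h1 := N.sub_count_le_exec w (fun a => (y a : ℤ), q) ⟨v, a⟩
    have h2 := hzy ⟨v, a⟩
    rw [hw] at h1
    simp only [Pi.zero_apply, Nat.cast_zero] at h1 h2
    change f v a ≤ w.count ⟨v, a⟩
    omega
  obtain ⟨g, hg⟩ := exists_add_of_le hle
  have h1 : q v = e v ((N.proc v).trans g (q v)) := by
    have := N.exec_snd w (fun a => (y a : ℤ), q) v
    rw [hw, hyq] at this
    refine this.trans ?_
    change (N.proc v).trans (fun a => w.count ⟨v, a⟩) (q v) = _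
    rw [hg, (N.proc v).trans_add, hf]
    rfl
  rw [h1]
  exact congrFun (he v).2.1 _

/-! ### Spreading of abundance -/

variable [∀ v, Finite (Q v)]

/-- Each round uses new copies of x to collect enough letters of R, spends some to send at least one
a, and sets the rest aside. Rounds can be repeated without limit. -/
theorem Abundant.insert {x : Letter A → ℕ} {R : Set (Letter A)} (hR : N.Abundant x R)
    {a : Letter A} (ha : a ∉ R)
    (hu : ∀ p, ∃ u : Letter A → ℕ, (∀ b ∉ R, u b = 0) ∧ N.sent u p a ≠ 0) :
    N.Abundant x (insert a R) := by
  have := Fintype.ofFinite (∀ v, Q v)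
  choose u hu0 hua using hu
  -- As there are finitely many states, one bound covers whatever state p' is reached.
  have hB : ∀ p b, u p b ≤ ∑ p, ∑ b, u p b := fun p b =>
    (Finset.single_le_sum (f := u p) (fun _ _ => zero_le) (Finset.mem_univ b)).trans
      (Finset.single_le_sum (f := fun p => ∑ b, u p b) (fun _ _ => zero_le) (Finset.mem_univ p))
  have key : ∀ (j C : ℕ) (p : ∀ v, Q v), ∃ (n : ℕ) (y : Letter A → ℕ)
      (p' : ∀ v, Q v), N.Leads (n • x) p y p' ∧ (∀ b ∈ R, C ≤ y b) ∧ j ≤ y a := by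
    intro j
    induction j with
    | zero =>
      intro C p
      obtain ⟨n, y, p', h, hy⟩ := hR C p
      exact ⟨n, y, p', h, hy, zero_le⟩
    | succ j ih =>
      intro C p
      obtain ⟨n, y, p', h, hy⟩ := hR (∑ p, ∑ b, u p b) p
      have hle : u p' ≤ y := by
        intro b
        by_cases hb : b ∈ R
        · exact (hB p' b).trans (hy b hb)
        · rw [hu0 p' b hb]; exact zero_le
      obtain ⟨d, rfl⟩ := exists_add_of_le hle
      -- The later rounds supply j letters a and the C letters of each kind in R; this round adds
      -- one more a.
      obtain ⟨n', y', p'', h', hy', hj⟩ := ih C (N.localState (u p') p')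
      refine ⟨_, _, _, (h.trans ((N.leads_localState (u p') p').add_right d)).add_nsmul h',
        fun b hb => (hy' b hb).trans le_add_self, ?_⟩
      have h1 := N.sent_nonneg (u p') p' a
      have h2 := hua p'
      simp only [Pi.add_apply, posVec, Pi.zero_apply] at h1 ⊢
      omega
  intro C p
  obtain ⟨n, y, p', h, hy, hj⟩ := key C C p
  refine ⟨n, y, p', h, ?_⟩
  rintro b (rfl | hb)
  · exact hj
  · exact hy b hb


/-- In an irreducible network, if letters in `R` never produce the letter `a` from some state,
then they produce a bounded number of letters `a` from any state. -/
theorem IsIrreducible.exists_sent_le (hirr : N.IsIrreducible) {R : Set (Letter A)} {a : Letter A}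
    {p : ∀ v, Q v} (hp : ∀ u : Letter A → ℕ, (∀ b ∉ R, u b = 0) → N.sent u p a = 0) :
    ∃ C : ℤ, ∀ (q : ∀ v, Q v) (u : Letter A → ℕ), (∀ b ∉ R, u b = 0) → N.sent u q a ≤ C := by
  choose f g hfg using fun q => hirr.exists_localState_eq q p
  have bound : ∀ q, ∃ C : ℤ, ∀ u : Letter A → ℕ, (∀ b ∉ R, u b = 0) → N.sent u q a ≤ C := by
    intro q
    obtain ⟨C, hC⟩ := (Set.finite_range fun s => N.sent (g q) s a).bddAbove
    obtain ⟨D, hD⟩ := (Set.finite_range fun s => N.sent (f q) s a).bddAbove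
    -- Let f and g carry q and p to a common state. By commutativity, u sends from q at most what f
    -- sends from q plus what u sends from that common state. Comparing orders at p, where u sends
    -- no a, bounds the latter by what g sends after u.
    refine ⟨C + D, fun u hu => ?_⟩
    have h1 := congrFun (N.sent_add_localState u (f q) q) a
    have h2 := congrFun (N.sent_add_localState (f q) u q) a
    have h3 := congrFun (N.sent_add_localState u (g q) p) a
    have h4 := congrFun (N.sent_add_localState (g q) u p) a
    rw [add_comm, hfg] at h2
    rw [add_comm] at h4
    have h5 := hC ⟨N.localState u p, rfl⟩
    have h6 := hD ⟨q, rfl⟩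
    have h7 := N.sent_nonneg (f q) (N.localState u q) a
    have h8 := N.sent_nonneg (g q) p a
    have h9 := hp u hu
    simp only [Pi.add_apply, Pi.zero_apply] at *
    linarith
  choose C hC using bound
  obtain ⟨D, hD⟩ := (Set.finite_range C).bddAbove
  exact ⟨D, fun q u hu => (hC q u hu).trans (hD ⟨q, rfl⟩)⟩

/-- If processing any multiple of `c` reproduces `c` up to a bounded defect, then `c = 0`. -/
theorem eq_zero_of_bounded_defect (h : N.HaltsOnAllInputs) {c : Letter A → ℕ} {r : ∀ v, Q v}
    (hc : ∀ a, c a ≠ 0 → ∃ C : ℤ, ∀ n : ℕ, (n * c a : ℤ) - C ≤ N.sent (n • c) r a) : c = 0 := by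
  obtain ⟨i, j, hij, hs⟩ := Finite.exists_ne_map_eq_of_infinite fun n : ℕ => N.localState (n • c) r
  wlog hlt : i < j generalizing i j
  · exact this j i hij.symm hs.symm (by omega)
  obtain ⟨d, rfl⟩ := Nat.exists_eq_add_of_lt hlt
  set s := N.localState (i • c) r with hs'
  have hper : N.localState ((d + 1) • c) s = s := by
    rw [hs', ← localState_add, ← add_smul]
    exact hs.symm
  have h0 : (d + 1) • c = 0 := by
    refine N.eq_zero_of_le_sent h hper fun a => ?_
    by_cases ha : c a = 0
    · have := N.sent_nonneg ((d + 1) • c) s a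
      simpa [ha] using this
    obtain ⟨C, hC⟩ := hc a ha
    by_contra! hlt
    -- If a period sent fewer a than it uses, each period would lose at least one a; this n exceeds
    -- the loss that C allows.
    obtain ⟨n, hn⟩ := exists_nat_gt (C + N.sent (i • c) r a - i * c a)
    have h1 := hC (i + n * (d + 1))
    rw [add_smul, mul_smul, sent_add_localState, ← hs', Pi.add_apply, N.sent_nsmul hper] at h1
    rw [Pi.smul_apply, smul_eq_mul] at hlt
    push_cast at h1 hlt
    nlinarith
  funext a
  simpa using congrFun h0 a

/-- If `k ≥ 1` returns `r` to itself and `sent k r + x = k`, then all letters are abundant. -/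
theorem IsIrreducible.abundant_univ (hirr : N.IsIrreducible) (h : N.HaltsOnAllInputs)
    {x k : Letter A → ℕ} {r : ∀ v, Q v} (hk : ∀ a, k a ≠ 0) (hkr : N.localState k r = r)
    (hx : ∀ a, N.sent k r a + x a = k a) : N.Abundant x Set.univ := by
  classical
  obtain ⟨R, hR⟩ := (Set.toFinite {R | N.Abundant x R ∧ {a | x a ≠ 0} ⊆ R}).exists_maximal
    ⟨_, abundant_support x, subset_rfl⟩
  obtain ⟨hRa, hRx⟩ := hR.prop
  have hbound : ∀ a ∉ R, ∃ C : ℤ, ∀ (q : ∀ v, Q v) (u : Letter A → ℕ),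
      (∀ b ∉ R, u b = 0) → N.sent u q a ≤ C := by
    intro a ha
    by_contra hcon
    have hins : N.Abundant x (insert a R) := hRa.insert ha fun p => by
      by_contra! hp
      exact hcon (hirr.exists_sent_le hp)
    exact ha (hR.le_of_ge ⟨hins, hRx.trans (Set.subset_insert a R)⟩ (Set.subset_insert a R)
      (Set.mem_insert a R))
  let c : Letter A → ℕ := fun a => if a ∈ R then 0 else k a
  let d : Letter A → ℕ := fun a => if a ∈ R then k a else 0
  have hcd : c + d = k := by
    funext a
    simp only [c, d, Pi.add_apply]
    split_ifs <;> simp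
  have hc : c = 0 := by
    refine N.eq_zero_of_bounded_defect h (r := r) fun a hca => ?_
    have ha : a ∉ R := fun ha => hca (by simp [c, ha])
    obtain ⟨C, hC⟩ := hbound a ha
    refine ⟨C, fun n => ?_⟩
    have h1 := congrFun (N.sent_add_localState (n • c) (n • d) r) a
    rw [← smul_add, hcd, N.sent_nsmul hkr, Pi.add_apply] at h1
    -- In nk = nc + nd, the letters nd lie in R and contribute at most C letters a, even after nc.
    have h2 := hC (N.localState (n • c) r) (n • d) fun b hb => by simp [d, hb]
    have h3 := hx a
    have h4 : x a = 0 := by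
      by_contra hxa
      exact ha (hRx hxa)
    have h5 : c a = k a := by simp [c, ha]
    rw [h4, Nat.cast_zero, add_zero] at h3
    rw [h3] at h1
    rw [h5]
    linarith
  have hall : R = Set.univ := by
    refine Set.eq_univ_of_forall fun a => ?_
    by_contra ha
    have := congrFun hc a
    simp only [c, ha, if_false] at this
    exact hk a this
  exact hall ▸ hRa

end AbelianNetwork

/-! ### The recurrence criterion. -/

theorem theorem5p4 {V : Type*} [Fintype V] {G : Digraph V} {A Q : V → Type*}
    [∀ v, Fintype (A v)] [∀ v, Finite (Q v)] (N : AbelianNetwork G A Q)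
    (hirr : N.IsIrreducible) (hhalt : N.HaltsOnAllInputs)
    (r : ∀ v, Q v) (hr : N.IsLocallyRecurrent r)
    (k : N.totalKernel) (hk : 1 ≤ (k : Letter A → ℤ))
    (hPk : N.production r hr k ≤ (k : Letter A → ℤ)) (q : ∀ v, Q v) :
    N.IsRecurrent hhalt q ↔
      N.globalAct hhalt (posVec ((k : Letter A → ℤ) - N.production r hr k)) q = q := by
  set x := posVec ((k : Letter A → ℤ) - N.production r hr k) with hxdef
  have hk0 : 0 ≤ k.1 := zero_le_one.trans hk
  have hprod := N.localAct_eq_production r hr k hk0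
  have hstate : ∀ s, N.IsLocallyRecurrent s → N.localState (posVec k.1) s = s := fun s hs =>
    congrArg Prod.snd (N.localAct_eq_production s hs k hk0)
  have hsent : N.sent (posVec k.1) r = N.production r hr k := congrArg Prod.fst hprod
  have hx : ∀ a, N.sent (posVec k.1) r a + x a = posVec k.1 a := by
    intro a
    have h1 := hPk a
    have h2 := hk0 a
    rw [hsent]
    simp only [hxdef, posVec, Pi.sub_apply, Pi.zero_apply] at h1 h2 ⊢
    omega
  constructor
  · intro hq
    have hql := hq.isLocallyRecurrent hr
    obtain ⟨y, hy, hyq⟩ := hq.exists_le_globalAct_eq hhalt (posVec k.1)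
    obtain ⟨d, rfl⟩ := exists_add_of_le hy
    have hl := (N.leads_localState (posVec k.1) q).add_right d
    rw [hstate q hql, hirr.sent_eq (hstate q hql) (hstate r hr)] at hl
    have h1 := hl.globalAct_eq hhalt
    have h2 : x + (posVec (N.sent (posVec k.1) r) + d) = posVec k.1 + d := by
      funext a
      have h3 := hx a
      have h4 := N.sent_nonneg (posVec k.1) r a
      change x a + ((N.sent (posVec k.1) r a).toNat + d a) = posVec k.1 a + d a
      simp only [Pi.zero_apply] at h4
      omega
    calc N.globalAct hhalt x q = N.globalAct hhalt x (N.globalAct hhalt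
          (posVec (N.sent (posVec k.1) r) + d) q) := by rw [← h1, hyq]
      _ = q := by rw [← N.globalAct_add, h2, hyq]
  · intro hq
    obtain ⟨z, hz⟩ := N.exists_isMinimalIdempotent hhalt
    have hab := hirr.abundant_univ hhalt (fun a => by
      have := hk a
      simp only [posVec, Pi.one_apply] at this ⊢
      omega) (hstate r hr) hx
    -- The total of z bounds each of its coordinates, so y ≥ z.
    obtain ⟨n, y, p, hl, hy⟩ := hab (∑ a, z a) q
    have hnq : N.globalAct hhalt (n • x) q = q := by
      clear hl
      induction n with
      | zero => rw [zero_smul, N.globalAct_zero]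
      | succ n ih => rw [succ_nsmul, N.globalAct_add, hq, ih]
    rw [← hnq, hl.globalAct_eq hhalt]
    exact AbelianNetwork.isRecurrent_globalAct hhalt hz (fun a =>
      (Finset.single_le_sum (f := z) (fun _ _ => zero_le) (Finset.mem_univ a)).trans
        (hy a trivial)) p
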